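/- A triangulation consists of finitely many tetrahedra, with vertices labelled $0,1,2,3$, some of whose faces are affinely glued in pairs. Within a tetrahedron, fold two faces together means: glue the two faces containing the edge $01$ by the affine map that fixes $0$ and $1$ and exchanges $2$ and $3$. The \emph{4-block} is the triangulation with boundary made from tetrahedra $\Delta_1,\Delta_2,\Delta_3,\Delta_4$ as follows ($\Delta(abc)\to\Delta'(a'b'c')$ means that the face $abc$ of $\Delta$ is glued to the face $a'b'c'$ of $\Delta'$ with $a\mapsto a'$, $b\mapsto b'$, $c\mapsto c'$). Fold together two faces of $\Delta_1$, $\Delta_1(012)\to\Delta_1(013)$; wrap $\Delta_2$ around the other two faces of $\Delta_1$, $\Delta_1(023)\to\Delta_2(123)$ and $\Delta_1(123)\to\Delta_2(023)$, to obtain a triangular pillow; fold together two faces of $\Delta_3$ and of $\Delta_4$, $\Delta_3(012)\to\Delta_3(013)$ and $\Delta_4(012)\to\Delta_4(013)$; and glue the two faces of the pillow to $\Delta_3$ and $\Delta_4$ by $\Delta_2(012)\to\Delta_3(032)$ and $\Delta_2(013)\to\Delta_4(023)$. The two remaining faces $123$ of $\Delta_3$ and $123$ of $\Delta_4$ form the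 boundary; their vertices are $R,P,P$ and $Q,P,P$ respectively, where $P,Q,R$ are the three boundary vertices of the 4-block. For $k\ge 1$ the \emph{pathological triangulation} $\mathcal X_k$ is built from $k$ copies $\mathcal B_1,\dots,\mathcal B_k$ of the 4-block, all with the same orientation, by gluing, for each $i=1,\dots,k$ (with $\mathcal B_{k+1}=\mathcal B_1$), the boundary triangle $P_iP_iR_i$ of $\mathcal B_i$ to the boundary triangle $Q_{i+1}P_{i+1}P_{i+1}$ of $\mathcal B_{i+1}$ by an orientation-preserving twisted identification, that is, one that sends a vertex $P_i$ to $Q_{i+1}$ and sends $R_i$ to a vertex $P_{i+1}$. (In terms of labels, the face $123$ of $\Delta_3$ in $\mathcal B_i$ is glued to the face $123$ of $\Delta_4$ in $\mathcal B_{i+1}$ by the transposition $(1\,2)$ or $(1\,3)$; the statement holds for any choice of these for $i=1,\dots,k$.) In a triangulation with $n$ tetrahedra, a \emph{normal surface} is given by a vector in $\mathbb Z^{7n}$ that counts the discs of each of the four triangle types and three quadrilateral types in each tetrahedron, subject to: (i) all coordinates are non-negative; (ii) the matching equations hold, i.e. across each pair of glued faces, the numbers of normal arcs around each of the three vertices of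 the face agree; (iii) each tetrahedron has at most one non-zero quadrilateral coordinate. A \emph{vertex normal surface} is a normal surface that lies on an extremal ray of the cone in $\mathbb R^{7n}$ defined by (i) and (ii) and that is not a multiple of a smaller normal surface. \textbf{Lemma.} For each $k\ge 1$, the triangulation $\mathcal X_k$, which has $n=4k$ tetrahedra, has precisely $\sigma=17^k+k$ vertex normal surfaces. -/

import Mathlib

/-! ## Triangulations and normal coordinates -/

/-- A triangulation (possibly with boundary) whose tetrahedra are indexed by `ι`. The vertices of
each tetrahedron are numbered by `Fin 4`, and face `f` is the face opposite vertex `f`.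
`glue t f = none` says that face `f` of tetrahedron `t` is a boundary face.
`glue t f = some (u, p)` says that face `f` of tetrahedron `t` is affinely identified with
face `p f` of tetrahedron `u`, each vertex `v ≠ f` of that face going to vertex `p v` of `u`. -/
structure Triangulation (ι : Type*) where
  glue : ι → Fin 4 → Option (ι × Equiv.Perm (Fin 4))
  glue_symm : ∀ t f u p, glue t f = some (u, p) → glue u (p f) = some (t, p⁻¹)
  glue_ne : ∀ t f u p, glue t f = some (u, p) → (u, p f) ≠ (t, f)

/-- The seven normal disc types in a tetrahedron: `Sum.inl v` is the triangle that cuts off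
vertex `v`; `Sum.inr 0`, `Sum.inr 1`, `Sum.inr 2` are the quadrilaterals that separate the vertices
as `01|23`, `02|13`, `03|12` respectively. -/
abbrev NormalDisc : Type := Fin 4 ⊕ Fin 3

/-- For `v ≠ w`, the quadrilateral type that separates `{v, w}` from the other two vertices
(the value for `v = w` is never used). -/
def quadType : Fin 4 → Fin 4 → Fin 3
  | 0, 1 | 1, 0 | 2, 3 | 3, 2 => 0
  | 0, 2 | 2, 0 | 1, 3 | 3, 1 => 1
  | 0, 3 | 3, 0 | 1, 2 | 2, 1 => 2
  | _, _ => 0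

/-- The number of normal arcs around vertex `v` in face `f` (where `v ≠ f`) of a tetrahedron that
contains `x d` discs of each type `d`: these arcs come from the triangles around `v` and from the
quadrilaterals that separate `v` from the other two vertices of the face. -/
def arcWeight {R : Type*} [Add R] (x : NormalDisc → R) (f v : Fin 4) : R :=
  x (Sum.inl v) + x (Sum.inr (quadType v f))

namespace Triangulation

variable {ι : Type*} (T : Triangulation ι)

/-- The number of tetrahedra. -/
def size {ι : Type*} [Fintype ι] (_T : Triangulation ι) : ℕ := Fintype.card ι

/-- The matching equations: across every glued pair of faces, the numbers of normal arcs of each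
of the three types agree. -/
def Matching {R : Type*} [Add R] (x : ι → NormalDisc → R) : Prop :=
  ∀ t f u p, T.glue t f = some (u, p) → ∀ v, v ≠ f →
    arcWeight (x t) f v = arcWeight (x u) (p f) (p v)

/-- The quadrilateral constraints: each tetrahedron has at most one non-zero quadrilateral
coordinate. -/
def QuadConstraints {ι R : Type*} [Zero R] (x : ι → NormalDisc → R) : Prop :=
  ∀ t q q', x t (Sum.inr q) ≠ 0 → x t (Sum.inr q') ≠ 0 → q = q'

/-- The cone of non-negative real vectors that satisfy the matching equations. The projective
solution space is a cross-section of this cone. -/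
def solutionCone : Set (ι → NormalDisc → ℝ) :=
  {x | (∀ t d, 0 ≤ x t d) ∧ T.Matching x}

/-- A normal surface, given by its vector of disc counts: an admissible integer vector. -/
def IsNormalSurface (x : ι → NormalDisc → ℤ) : Prop :=
  (∀ t d, 0 ≤ x t d) ∧ T.Matching x ∧ QuadConstraints x

/-- The real vector `x` spans an extremal ray of the solution cone. -/
def OnExtremalRay (x : ι → NormalDisc → ℝ) : Prop :=
  x ∈ T.solutionCone ∧ x ≠ 0 ∧
    ∀ y ∈ T.solutionCone, ∀ z ∈ T.solutionCone, y + z = x → ∃ c : ℝ, y = c • x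

/-- A vertex normal surface: a normal surface that lies on an extremal ray of the solution cone
and is not a multiple of a smaller normal surface. -/
def IsVertexNormalSurface (x : ι → NormalDisc → ℤ) : Prop :=
  T.IsNormalSurface x ∧
  T.OnExtremalRay (fun t d => (x t d : ℝ)) ∧
  ¬ ∃ (w : ι → NormalDisc → ℤ) (m : ℕ), T.IsNormalSurface w ∧ 2 ≤ m ∧ x = m • w

/-- The admissible vertex count `σ`: the number of vertex normal surfaces. -/
noncomputable def vertexCount : ℕ := {x | T.IsVertexNormalSurface x}.ncard

end Triangulation

/-! ## The 4-block and the pathological triangulations -/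

/-- The face gluings of the 4-block. Tetrahedra `0, 1, 2, 3` are `Δ₁, Δ₂, Δ₃, Δ₄`.
Writing `S` for the internal vertex and `P, Q, R` for the three boundary vertices, the vertices
`0, 1, 2, 3` of `Δ₁` are `P, S, P, P`, those of `Δ₂` are `S, P, P, P`, those of `Δ₃` are
`S, R, P, P`, and those of `Δ₄` are `S, Q, P, P`.
All gluing permutations are odd, so the tetrahedra are consistently oriented by their
vertex numbering. -/
def fourBlockGlue : Fin 4 → Fin 4 → Option (Fin 4 × Equiv.Perm (Fin 4))
  -- two faces of `Δ₁` are folded together around its edge `01`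
  | 0, 3 => some (0, Equiv.swap 2 3)
  | 0, 2 => some (0, Equiv.swap 2 3)
  -- `Δ₂` is wrapped around the other two faces of `Δ₁`, which share the edge `23`;
  -- this gives the triangular pillow, with boundary faces `Δ₂(0,1,2)` and `Δ₂(0,1,3)`
  | 0, 0 => some (1, Equiv.swap 0 1)
  | 0, 1 => some (1, Equiv.swap 0 1)
  | 1, 1 => some (0, Equiv.swap 0 1)
  | 1, 0 => some (0, Equiv.swap 0 1)
  -- two faces of `Δ₃` are folded together, and likewise for `Δ₄`
  | 2, 3 => some (2, Equiv.swap 2 3)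
  | 2, 2 => some (2, Equiv.swap 2 3)
  | 3, 3 => some (3, Equiv.swap 2 3)
  | 3, 2 => some (3, Equiv.swap 2 3)
  -- one face of the pillow is glued to `Δ₃`, the other one to `Δ₄`
  | 1, 3 => some (2, Equiv.swap 1 3)
  | 2, 1 => some (1, Equiv.swap 1 3)
  | 1, 2 => some (3, Equiv.swap 1 2)
  | 3, 1 => some (1, Equiv.swap 1 2)
  -- the two boundary faces, with vertices `R, P, P` and `Q, P, P`
  | 2, 0 => none
  | 3, 0 => none

/-- The 4-block. -/
def fourBlock : Triangulation (Fin 4) where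
  glue := fourBlockGlue
  glue_symm := by
    intro t f u p h
    fin_cases t <;> fin_cases f <;> simp [fourBlockGlue] at h <;>
      obtain ⟨rfl, rfl⟩ := h <;> decide
  glue_ne := by
    intro t f u p h
    fin_cases t <;> fin_cases f <;> simp [fourBlockGlue] at h <;>
      obtain ⟨rfl, rfl⟩ := h <;> decide

/-- The twisted orientation-preserving identifications of the boundary face `1, 2, 3` of `Δ₃`
(with vertices `R, P, P`) with the boundary face `1, 2, 3` of `Δ₄` in the next block (with vertices
`Q, P, P`). The vertex `R` goes to a vertex `P`, and a vertex `P` goes to `Q`; the odd permutations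
with this property are exactly these two. -/
def twistGlue : Bool → Equiv.Perm (Fin 4)
  | true => Equiv.swap 1 2
  | false => Equiv.swap 1 3

theorem twistGlue_zero (b : Bool) : twistGlue b 0 = 0 := by
  cases b <;> decide

theorem twistGlue_inv (b : Bool) : (twistGlue b)⁻¹ = twistGlue b := by
  cases b <;> decide

/-- The face gluings of the pathological triangulation: gluings within the `i`-th block are those
of the 4-block, and the boundary face `R, P, P` of block `i` is glued to the boundary face
`Q, P, P` of the cyclically next block by the twisted identification `twistGlue (s i)`. -/
def pathologicalGlue (k : ℕ) (s : Fin k → Bool) (t : Fin k × Fin 4) (f : Fin 4) :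
    Option ((Fin k × Fin 4) × Equiv.Perm (Fin 4)) :=
  match fourBlock.glue t.2 f with
  | some (u, p) => some ((t.1, u), p)
  | none =>
    if t.2 = 2 then some ((finRotate k t.1, 3), twistGlue (s t.1))
    else some (((finRotate k).symm t.1, 2), twistGlue (s ((finRotate k).symm t.1)))

/-- The pathological triangulation `𝒳ₖ`, built from `k` copies of the 4-block. -/
def pathological (k : ℕ) (s : Fin k → Bool) : Triangulation (Fin k × Fin 4) where
  glue := pathologicalGlue k s
  glue_symm := by
    rintro ⟨i, t⟩ f u p h
    fin_cases t <;> fin_cases f <;>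
      simp [pathologicalGlue, fourBlock, fourBlockGlue, -finRotate_apply,
        -finRotate_symm_apply] at h <;>
      obtain ⟨rfl, rfl⟩ := h <;>
      simp [pathologicalGlue, fourBlock, fourBlockGlue, twistGlue_zero, twistGlue_inv,
        -finRotate_apply, -finRotate_symm_apply]
  glue_ne := by
    rintro ⟨i, t⟩ f u p h
    fin_cases t <;> fin_cases f <;>
      simp [pathologicalGlue, fourBlock, fourBlockGlue] at h <;>
      obtain ⟨rfl, rfl⟩ := h <;>
      simp

/-! ## Parametrization of the solutions by quadrilateral coordinates -/

/-! Each fold makes the counts of two quadrilateral types equal, so admissibility kills both;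
wrapping does the same to `Δ₂`. The twists equate the weights of all `P`, `Q`, `R`. Hence admissible
solutions form a linear family: one global `p` and five free parameters per block
(`exists_eq_surfaceVec`, used over ℤ for surfaces and over ℝ for summands). At `p = 1` the blocks
are independent, each with the polyhedron `0 ≤ q₂ ≤ 1`, `0 ≤ q₃, q₄ ≤ min 1 link`, `0 ≤ q₁ ≤ q₂ +
min 1 link`. It has 17 vertices and one unbounded direction, `link`. Vertices of a product are
tuples of vertices, giving `17 ^ k` rays; at `p = 0` only the `k` internal vertex links remain.
Completeness is proved through supports: every nonzero admissible integer solution dominates half of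
a listed one (`exists_blockVertex_le`), and extremality then forces equality (`eq_of_le_two_mul`).
-/

/-- The free parameters of a solution of the matching equations in one 4-block, apart from the
common weight `p` of the boundary vertex `P`: the weight `link` of the internal vertex in `Δ₂`, and
the coordinates `q₁, q₂, q₃, q₄` of the quadrilaterals `01|23` in the four tetrahedra. -/
structure BlockParams (R : Type*) where
  link : R
  q₁ : R
  q₂ : R
  q₃ : R
  q₄ : R

/-- The disc counts in one block determined by `p` and the block parameters. -/
def BlockParams.toVec {R : Type*} [Ring R] (p : R) (P : BlockParams R) :
    Fin 4 → NormalDisc → R :=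
  ![Sum.elim ![p + P.q₂ - P.q₁, P.link + P.q₂ - P.q₁, p - P.q₂, p - P.q₂] ![P.q₁, 0, 0],
    Sum.elim ![P.link, p, p - P.q₂, p - P.q₂] ![P.q₂, 0, 0],
    Sum.elim ![P.link - P.q₃, p - P.q₃, p, p] ![P.q₃, 0, 0],
    Sum.elim ![P.link - P.q₄, p - P.q₄, p, p] ![P.q₄, 0, 0]]

/-- The disc counts in the whole triangulation. -/
def surfaceVec {R : Type*} [Ring R] {k : ℕ} (p : R) (P : Fin k → BlockParams R)
    (t : Fin k × Fin 4) : NormalDisc → R :=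
  (P t.1).toVec p t.2

theorem matching_surfaceVec {R : Type*} [Ring R] {k : ℕ} (s : Fin k → Bool) (p : R)
    (P : Fin k → BlockParams R) : (pathological k s).Matching (surfaceVec p P) := by
  rintro ⟨i, t⟩ f u g h v hv
  fin_cases t <;> fin_cases f <;>
    simp [pathological, pathologicalGlue, fourBlock, fourBlockGlue, -finRotate_apply,
      -finRotate_symm_apply] at h <;>
    obtain ⟨rfl, rfl⟩ := h <;> fin_cases v <;>
    first
    | exact absurd rfl hv
    | (simp [arcWeight, quadType, surfaceVec, BlockParams.toVec, Equiv.swap_apply_def]; done)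
    | (cases s i <;>
        simp [arcWeight, quadType, surfaceVec, BlockParams.toVec, twistGlue,
          Equiv.swap_apply_def]; done)
    | (cases s ((finRotate k).symm i) <;>
        simp [arcWeight, quadType, surfaceVec, BlockParams.toVec, twistGlue,
          Equiv.swap_apply_def])

theorem quadConstraints_surfaceVec {R : Type*} [Ring R] {k : ℕ} (p : R)
    (P : Fin k → BlockParams R) :
    Triangulation.QuadConstraints (surfaceVec p P) := by
  rintro ⟨i, t⟩ q q' h h'
  fin_cases t <;> fin_cases q <;> fin_cases q' <;>
    simp_all [surfaceVec, BlockParams.toVec]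

theorem eq_of_forall_finRotate {α : Type*} {k : ℕ} {f : Fin k → α}
    (h : ∀ i, f (finRotate k i) = f i) (i j : Fin k) : f i = f j := by
  obtain _ | n := k
  · exact i.elim0
  have key : ∀ i : Fin (n + 1), f i = f 0 := by
    intro i
    induction i using Fin.induction with
    | zero => rfl
    | succ i ih => rw [← ih, ← h i.castSucc, finRotate_apply, Fin.coeSucc_eq_succ]
  rw [key i, key j]

/-- The mechanism by which folding removes two of the three quadrilateral types. -/
theorem Triangulation.QuadConstraints.eq_zero {ι R : Type*} [Zero R] {x : ι → NormalDisc → R}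
    (h : Triangulation.QuadConstraints x) {t : ι} {q q' : Fin 3} (hq : q ≠ q')
    (he : x t (Sum.inr q) = x t (Sum.inr q')) : x t (Sum.inr q) = 0 := by
  by_contra h0
  exact hq (h t q q' h0 (he ▸ h0))

/-- Every solution of the matching equations and quadrilateral constraints is of the form
`surfaceVec p P`. -/
theorem exists_eq_surfaceVec {R : Type*} [CommRing R] [LinearOrder R] [IsStrictOrderedRing R]
    {k : ℕ} (hk : 1 ≤ k) {s : Fin k → Bool}
    {x : Fin k × Fin 4 → NormalDisc → R} (hm : (pathological k s).Matching x)
    (hq : Triangulation.QuadConstraints x) :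
    ∃ (p : R) (P : Fin k → BlockParams R), x = surfaceVec p P := by
  have fold : ∀ i j, j = 0 ∨ j = 2 ∨ j = 3 → x (i, j) (.inr 1) = 0 ∧ x (i, j) (.inr 2) = 0 ∧
      x (i, j) (.inl 2) = x (i, j) (.inl 3) := by
    intro i j hj
    have e := hm (i, j) 3 (i, j) (Equiv.swap 2 3) (by rcases hj with rfl | rfl | rfl <;> rfl)
    have e0 := e 0 (by decide)
    have e2 := e 2 (by decide)
    simp [arcWeight, quadType, Equiv.swap_apply_def] at e0 e2
    exact ⟨hq.eq_zero (by decide) e0.symm, hq.eq_zero (by decide) e0, e2⟩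
  have wrap : ∀ i, x (i, 1) (.inr 1) = 0 ∧ x (i, 1) (.inr 2) = 0 ∧
      x (i, 1) (.inl 2) = x (i, 0) (.inl 2) ∧ x (i, 1) (.inl 3) = x (i, 0) (.inl 2) ∧
      x (i, 0) (.inl 1) + x (i, 0) (.inr 0) = x (i, 1) (.inl 0) + x (i, 1) (.inr 0) ∧
      x (i, 0) (.inl 0) + x (i, 0) (.inr 0) = x (i, 1) (.inl 1) + x (i, 1) (.inr 0) := by
    intro i
    obtain ⟨h1, h2, h3⟩ := fold i 0 (by simp)
    have e := hm (i, 0) 0 (i, 1) (Equiv.swap 0 1) rfl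
    have e1 := e 1 (by decide)
    have e2 := e 2 (by decide)
    have e3 := e 3 (by decide)
    have e' := hm (i, 0) 1 (i, 1) (Equiv.swap 0 1) rfl
    have e0' := e' 0 (by decide)
    have e2' := e' 2 (by decide)
    simp [arcWeight, quadType, Equiv.swap_apply_def, h1, h2] at e1 e2 e3 e0' e2'
    -- The two faces of `Δ₁` at vertex 2 see the same weight, which in `Δ₂` meets two different
    -- quadrilateral types.
    have e12 : x (i, 1) (.inr 1) = x (i, 1) (.inr 2) := by linarith
    have z1 := hq.eq_zero (by decide) e12
    have z2 := hq.eq_zero (by decide) e12.symm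
    refine ⟨z1, z2, ?_, ?_, e1, e0'⟩ <;> linarith
  have attach : ∀ i, x (i, 1) (.inl 0) = x (i, 2) (.inl 0) + x (i, 2) (.inr 0) ∧
      x (i, 1) (.inl 1) = x (i, 2) (.inl 3) ∧
      x (i, 1) (.inl 2) + x (i, 1) (.inr 0) = x (i, 2) (.inl 2) ∧
      x (i, 1) (.inl 0) = x (i, 3) (.inl 0) + x (i, 3) (.inr 0) ∧
      x (i, 1) (.inl 1) = x (i, 3) (.inl 2) := by
    intro i
    obtain ⟨h1, h2, -⟩ := fold i 2 (by simp)
    obtain ⟨h1', h2', -⟩ := fold i 3 (by simp)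
    obtain ⟨h1'', h2'', -⟩ := wrap i
    have e := hm (i, 1) 3 (i, 2) (Equiv.swap 1 3) rfl
    have e0 := e 0 (by decide)
    have e1 := e 1 (by decide)
    have e2 := e 2 (by decide)
    have e' := hm (i, 1) 2 (i, 3) (Equiv.swap 1 2) rfl
    have e0' := e' 0 (by decide)
    have e1' := e' 1 (by decide)
    simp [arcWeight, quadType, Equiv.swap_apply_def, h1, h2, h2', h1'', h2'']
      at e0 e1 e2 e0' e1'
    exact ⟨e0, e1, e2, e0', e1'⟩
  have twist : ∀ i, x (finRotate k i, 1) (.inl 1) = x (i, 1) (.inl 1) ∧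
      x (i, 2) (.inl 1) + x (i, 2) (.inr 0) = x (i, 1) (.inl 1) ∧
      x (finRotate k i, 3) (.inl 1) + x (finRotate k i, 3) (.inr 0) = x (i, 1) (.inl 1) := by
    intro i
    obtain ⟨h1, h2, h3⟩ := fold i 2 (by simp)
    obtain ⟨h1', h2', h3'⟩ := fold (finRotate k i) 3 (by simp)
    obtain ⟨-, a1, -, -, -⟩ := attach i
    obtain ⟨-, -, -, -, a2⟩ := attach (finRotate k i)
    have e := hm (i, 2) 0 (finRotate k i, 3) (twistGlue (s i)) rfl
    have e1 := e 1 (by decide)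
    have e2 := e 2 (by decide)
    have e3 := e 3 (by decide)
    cases hs : s i <;>
      simp [arcWeight, quadType, Equiv.swap_apply_def, hs, twistGlue, h1, h2, h1', h2',
        -finRotate_apply] at e1 e2 e3 <;>
      refine ⟨?_, ?_, ?_⟩ <;> linarith
  have hp := eq_of_forall_finRotate (f := fun i => x (i, 1) (.inl 1)) fun i => (twist i).1
  refine ⟨x (⟨0, hk⟩, 1) (.inl 1), fun i => ⟨x (i, 1) (.inl 0), x (i, 0) (.inr 0),
    x (i, 1) (.inr 0), x (i, 2) (.inr 0), x (i, 3) (.inr 0)⟩, ?_⟩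
  funext ⟨i, t⟩ d
  have hpi : x (i, 1) (.inl 1) = x (⟨0, hk⟩, 1) (.inl 1) := hp i ⟨0, hk⟩
  obtain ⟨f1, f2, f3⟩ := fold i 0 (by simp)
  obtain ⟨f4, f5, f6⟩ := fold i 2 (by simp)
  obtain ⟨f7, f8, f9⟩ := fold i 3 (by simp)
  obtain ⟨w1, w2, w3, w4, w5, w6⟩ := wrap i
  obtain ⟨a1, a2, a3, a4, a5⟩ := attach i
  obtain ⟨-, r, -⟩ := twist i
  -- The face `QPP` of block `i` is glued to the preceding block, so its equation is `twist` at the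
  -- predecessor.
  have r' : x (i, 3) (.inl 1) + x (i, 3) (.inr 0) = x (i, 1) (.inl 1) := by
    obtain ⟨j, rfl⟩ := (finRotate k).surjective i
    rw [(twist j).2.2]
    exact hp _ _
  rcases d with v | q
  · fin_cases t <;> fin_cases v <;> simp [surfaceVec, BlockParams.toVec] <;> linarith
  · fin_cases t <;> fin_cases q <;> simp [surfaceVec, BlockParams.toVec] <;> linarith

/-! ## The vertex solutions -/

/-- The seventeen vertex solutions of weight `p = 1` in a block. In the family
`some (full, b, c, d)` the quadrilateral coordinates of the last three tetrahedra are `b, c, d`,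
and that of the first one is maximal if `full` holds and zero otherwise. -/
abbrev BlockVertex : Type := Option (Bool × Bool × Bool × Bool)

/-- The parameters of a vertex solution in a block. -/
def BlockVertex.params : BlockVertex → BlockParams ℤ
  | none => ⟨0, 1, 1, 0, 0⟩
  | some (true, b, c, d) => ⟨1, b.toNat + 1, b.toNat, c.toNat, d.toNat⟩
  | some (false, b, c, d) => ⟨(c || d).toNat, 0, b.toNat, c.toNat, d.toNat⟩

/-- The parameters of the link of the internal vertex of block `i`. -/
def linkParams {k : ℕ} (i j : Fin k) : BlockParams ℤ :=
  ⟨if j = i then 1 else 0, 0, 0, 0, 0⟩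

/-- The vertex normal surfaces of the pathological triangulation. -/
def vertexSurface {k : ℕ} : (Fin k → BlockVertex) ⊕ Fin k → Fin k × Fin 4 → NormalDisc → ℤ
  | .inl V => surfaceVec 1 fun i => (V i).params
  | .inr i => surfaceVec 0 (linkParams i)

theorem vertexSurface_inl {k : ℕ} (V : Fin k → BlockVertex) :
    vertexSurface (.inl V) = surfaceVec 1 fun i => (V i).params :=
  rfl

theorem vertexSurface_inr {k : ℕ} (i : Fin k) :
    vertexSurface (.inr i) = surfaceVec 0 (linkParams i) :=
  rfl

theorem BlockVertex.toVec_nonneg (V : BlockVertex) (t : Fin 4) (d : NormalDisc) :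
    0 ≤ V.params.toVec 1 t d := by
  revert V t d
  decide

theorem BlockVertex.params_injective : Function.Injective BlockVertex.params := by
  intro V W h
  have h' : V.params.toVec 1 = W.params.toVec 1 := by rw [h]
  clear h
  revert V W
  decide

theorem BlockParams.toVec_injective {R : Type*} [Ring R] (p : R) :
    Function.Injective (BlockParams.toVec p) := by
  rintro ⟨a, b, c, d, e⟩ ⟨a', b', c', d', e'⟩ h
  have h1 := congrFun (congrFun h 1) (.inl 0)
  have h2 := congrFun (congrFun h 0) (.inr 0)
  have h3 := congrFun (congrFun h 1) (.inr 0)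
  have h4 := congrFun (congrFun h 2) (.inr 0)
  have h5 := congrFun (congrFun h 3) (.inr 0)
  simp [BlockParams.toVec] at h1 h2 h3 h4 h5
  subst h1 h2 h3 h4 h5
  rfl

theorem vertexSurface_injective {k : ℕ} :
    Function.Injective (vertexSurface (k := k)) := by
  have hne : ∀ (V : Fin k → BlockVertex) (i : Fin k),
      vertexSurface (.inl V) ≠ vertexSurface (.inr i) := by
    intro V i h
    have := congrFun (congrFun h (i, 1)) (.inl 1)
    simp [vertexSurface, surfaceVec, BlockParams.toVec] at this
  rintro (V | i) (W | j) h
  · congr 1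
    funext i
    apply BlockVertex.params_injective
    apply BlockParams.toVec_injective 1
    funext t
    exact congrFun h (i, t)
  · exact absurd h (hne _ _)
  · exact absurd h.symm (hne _ _)
  · have := congrFun (congrFun h (i, 1)) (.inl 0)
    simp [vertexSurface, surfaceVec, BlockParams.toVec, linkParams] at this
    rw [this]

theorem linkParams_toVec_nonneg {k : ℕ} (i j : Fin k) (t : Fin 4) (d : NormalDisc) :
    0 ≤ (linkParams i j).toVec 0 t d := by
  have h : (0 : ℤ) ≤ if j = i then 1 else 0 := by split_ifs <;> decide
  rcases d with v | q
  · fin_cases t <;> fin_cases v <;> simp [linkParams, BlockParams.toVec, h]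
  · fin_cases t <;> fin_cases q <;> simp [linkParams, BlockParams.toVec]

theorem isNormalSurface_vertexSurface {k : ℕ} (s : Fin k → Bool)
    (c : (Fin k → BlockVertex) ⊕ Fin k) :
    (pathological k s).IsNormalSurface (vertexSurface c) := by
  rcases c with V | i
  · rw [vertexSurface_inl]
    exact ⟨fun t d => (V t.1).toVec_nonneg _ _, matching_surfaceVec _ _ _,
      quadConstraints_surfaceVec _ _⟩
  · rw [vertexSurface_inr]
    exact ⟨fun t d => linkParams_toVec_nonneg _ _ _ _, matching_surfaceVec _ _ _,
      quadConstraints_surfaceVec _ _⟩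

/-- A coordinate equal to one shows that the surface is nonzero and not a proper multiple. -/
theorem exists_vertexSurface_eq_one {k : ℕ} (hk : 1 ≤ k) (c : (Fin k → BlockVertex) ⊕ Fin k) :
    ∃ t d, vertexSurface c t d = 1 := by
  rcases c with V | i
  · exact ⟨(⟨0, hk⟩, 1), .inl 1, by simp [vertexSurface, surfaceVec, BlockParams.toVec]⟩
  · exact ⟨(i, 1), .inl 0, by simp [vertexSurface, surfaceVec, BlockParams.toVec, linkParams]⟩

/-! ### Every vertex normal surface is listed -/

theorem Triangulation.Matching.intCast {ι : Type*} {T : Triangulation ι}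
    {x : ι → NormalDisc → ℤ} (h : T.Matching x) : T.Matching fun t d => (x t d : ℝ) := by
  intro t f u p hg v hv
  have := h t f u p hg v hv
  simp only [arcWeight] at this ⊢
  exact_mod_cast this

theorem Triangulation.IsNormalSurface.intCast_mem_solutionCone {ι : Type*} {T : Triangulation ι}
    {x : ι → NormalDisc → ℤ} (h : T.IsNormalSurface x) :
    (fun t d => (x t d : ℝ)) ∈ T.solutionCone :=
  ⟨fun t d => Int.cast_nonneg (h.1 t d), h.2.1.intCast⟩

/-- A vertex normal surface `x` equals any normal surface `y ≤ 2 x` that has a coordinate equal to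
one. -/
theorem Triangulation.IsVertexNormalSurface.eq_of_le_two_mul {ι : Type*} {T : Triangulation ι}
    {x y : ι → NormalDisc → ℤ} (hx : T.IsVertexNormalSurface x) (hy : T.IsNormalSurface y)
    (hle : ∀ t d, y t d ≤ 2 * x t d) {t₀ : ι} {d₀ : NormalDisc} (h1 : y t₀ d₀ = 1) : x = y := by
  obtain ⟨hn, ⟨-, -, hray⟩, hprim⟩ := hx
  have hymem : (fun t d => (y t d : ℝ) / 2) ∈ T.solutionCone := by
    refine ⟨fun t d => div_nonneg (Int.cast_nonneg (hy.1 t d)) two_pos.le, ?_⟩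
    intro t f u p hg v hv
    have := hy.2.1.intCast t f u p hg v hv
    simp only [arcWeight] at this ⊢
    linarith
  have hzmem : (fun t d => (x t d : ℝ) - (y t d : ℝ) / 2) ∈ T.solutionCone := by
    refine ⟨fun t d => ?_, ?_⟩
    · have : (y t d : ℝ) ≤ 2 * x t d := by exact_mod_cast hle t d
      linarith
    intro t f u p hg v hv
    have h1 := hy.2.1.intCast t f u p hg v hv
    have h2 := hn.2.1.intCast t f u p hg v hv
    simp only [arcWeight] at h1 h2 ⊢
    linarith
  -- Extremality is applied to `x = y/2 + (x - y/2)`.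
  obtain ⟨c, hc⟩ := hray _ hymem _ hzmem (by funext t d; simp)
  have hc' : ∀ t d, (y t d : ℝ) / 2 = c * x t d := fun t d => congrFun (congrFun hc t) d
  have hmul : ∀ t d, x t d = x t₀ d₀ * y t d := by
    intro t d
    have e0 := hc' t₀ d₀
    have e := hc' t d
    rw [h1] at e0
    have : (x t d : ℝ) = x t₀ d₀ * y t d := by
      push_cast at e0
      linear_combination (2 * x t d : ℝ) * e0 - (2 * x t₀ d₀ : ℝ) * e
    exact_mod_cast this
  -- Now `x` is `m` times `y`: primitivity excludes `m ≥ 2`, and `1 ≤ 2 * m` excludes zero.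
  obtain ⟨m, hm⟩ := Int.eq_ofNat_of_zero_le (hn.1 t₀ d₀)
  have hle0 := hle t₀ d₀
  have hm2 : ¬ 2 ≤ m := fun h => hprim ⟨y, m, hy, h, by
    funext t d
    rw [hmul t d, hm]
    simp⟩
  have hm1 : x t₀ d₀ = 1 := by omega
  funext t d
  rw [hmul t d, hm1, one_mul]

/-- Every solution in a block with `p > 0` supports one of the seventeen vertex solutions. -/
theorem exists_blockVertex_le {p : ℤ} (hp : 0 < p) {P : BlockParams ℤ}
    (h : ∀ t d, 0 ≤ P.toVec p t d) :
    ∃ V : BlockVertex, ∀ t d, V.params.toVec 1 t d ≤ 2 * P.toVec p t d := by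
  obtain ⟨s, a, b, c, d⟩ := P
  have h1 := h 0 (.inl 0)
  have h2 := h 0 (.inl 1)
  have h3 := h 0 (.inl 2)
  have h4 := h 0 (.inr 0)
  have h5 := h 1 (.inl 0)
  have h6 := h 1 (.inr 0)
  have h7 := h 2 (.inl 0)
  have h8 := h 2 (.inl 1)
  have h9 := h 2 (.inr 0)
  have h10 := h 3 (.inl 0)
  have h11 := h 3 (.inl 1)
  have h12 := h 3 (.inr 0)
  simp [BlockParams.toVec] at h1 h2 h3 h4 h5 h6 h7 h8 h9 h10 h11 h12
  suffices ∃ V : BlockVertex,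
      1 + V.params.q₂ - V.params.q₁ ≤ 2 * (p + b - a) ∧
      V.params.link + V.params.q₂ - V.params.q₁ ≤ 2 * (s + b - a) ∧
      1 - V.params.q₂ ≤ 2 * (p - b) ∧ V.params.q₁ ≤ 2 * a ∧
      V.params.link ≤ 2 * s ∧ V.params.q₂ ≤ 2 * b ∧
      V.params.link - V.params.q₃ ≤ 2 * (s - c) ∧ 1 - V.params.q₃ ≤ 2 * (p - c) ∧
      V.params.q₃ ≤ 2 * c ∧
      V.params.link - V.params.q₄ ≤ 2 * (s - d) ∧ 1 - V.params.q₄ ≤ 2 * (p - d) ∧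
      V.params.q₄ ≤ 2 * d by
    obtain ⟨V, g⟩ := this
    refine ⟨V, ?_⟩
    rintro t (v | q)
    · fin_cases t <;> fin_cases v <;> simp [BlockParams.toVec] <;> omega
    · fin_cases t <;> fin_cases q <;> simp [BlockParams.toVec] <;> omega
  -- The vertex is chosen with support inside that of the solution; as its entries are at most 2 and
  -- the solution is integral, the factor 2 suffices. If `a > 0` and `s = 0`, then `b ≥ a > 0` and
  -- `c = d = 0`, which is the exceptional vertex `none`.
  have cases_a : 0 < a ∧ 0 < s ∨ 0 < a ∧ s = 0 ∨ a = 0 := by omega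
  rcases cases_a with ha | ha | ha
  · refine ⟨some (true, decide (0 < b), decide (0 < c), decide (0 < d)), ?_⟩
    by_cases hb : 0 < b <;> by_cases hc : 0 < c <;> by_cases hd : 0 < d <;>
      simp [BlockVertex.params, hb, hc, hd] <;> omega
  · refine ⟨none, ?_⟩
    simp [BlockVertex.params]
    omega
  · refine ⟨some (false, decide (0 < b), decide (0 < c), decide (0 < d)), ?_⟩
    by_cases hb : 0 < b <;> by_cases hc : 0 < c <;> by_cases hd : 0 < d <;>
      simp [BlockVertex.params, hb, hc, hd] <;> omega

theorem Triangulation.IsVertexNormalSurface.exists_eq_vertexSurface {k : ℕ} (hk : 1 ≤ k)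
    {s : Fin k → Bool} {x : Fin k × Fin 4 → NormalDisc → ℤ}
    (hx : (pathological k s).IsVertexNormalSurface x) : ∃ c, vertexSurface c = x := by
  suffices ∃ c, ∀ t d, vertexSurface c t d ≤ 2 * x t d by
    obtain ⟨c, hc⟩ := this
    obtain ⟨t, d, h1⟩ := exists_vertexSurface_eq_one hk c
    exact ⟨c, (hx.eq_of_le_two_mul (isNormalSurface_vertexSurface s c) hc h1).symm⟩
  obtain ⟨⟨hnn, hm, hq⟩, ⟨-, hx0, -⟩, -⟩ := hx
  obtain ⟨p, P, rfl⟩ := exists_eq_surfaceVec hk hm hq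
  have hp : 0 ≤ p := by
    simpa [surfaceVec, BlockParams.toVec] using hnn (⟨0, hk⟩, 1) (.inl 1)
  rcases hp.eq_or_lt with rfl | hp
  -- For `p = 0` the bounds squeeze every quadrilateral coordinate to zero, leaving a sum of
  -- internal vertex links.
  · have hP : ∀ i, (P i).q₁ = 0 ∧ (P i).q₂ = 0 ∧ (P i).q₃ = 0 ∧ (P i).q₄ = 0 ∧
        0 ≤ (P i).link := by
      intro i
      have h1 := hnn (i, 0) (.inl 0)
      have h2 := hnn (i, 0) (.inr 0)
      have h3 := hnn (i, 0) (.inl 2)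
      have h4 := hnn (i, 1) (.inr 0)
      have h5 := hnn (i, 2) (.inl 1)
      have h6 := hnn (i, 2) (.inr 0)
      have h7 := hnn (i, 3) (.inl 1)
      have h8 := hnn (i, 3) (.inr 0)
      have h9 := hnn (i, 1) (.inl 0)
      simp [surfaceVec, BlockParams.toVec] at h1 h2 h3 h4 h5 h6 h7 h8 h9
      omega
    obtain ⟨i, hi⟩ : ∃ i, (P i).link ≠ 0 := by
      by_contra! hall
      apply hx0
      funext ⟨i, t⟩ d
      obtain ⟨e1, e2, e3, e4, -⟩ := hP i
      rcases d with v | q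
      · fin_cases t <;> fin_cases v <;>
          simp [surfaceVec, BlockParams.toVec, e1, e2, e3, e4, hall i]
      · fin_cases t <;> fin_cases q <;>
          simp [surfaceVec, BlockParams.toVec, e1, e2, e3, e4]
    refine ⟨.inr i, ?_⟩
    rintro ⟨j, t⟩ d
    obtain ⟨e1, e2, e3, e4, e5⟩ := hP j
    have key : (if j = i then (1 : ℤ) else 0) ≤ 2 * (P j).link := by
      split_ifs with hj
      · subst hj; omega
      · omega
    rcases d with v | q
    · fin_cases t <;> fin_cases v <;>
        simp [vertexSurface, linkParams, surfaceVec, BlockParams.toVec, e1, e2, e3, e4, key]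
    · fin_cases t <;> fin_cases q <;>
        simp [vertexSurface, linkParams, surfaceVec, BlockParams.toVec, e1, e2, e3, e4]
  · choose V hV using fun i => exists_blockVertex_le hp (P := P i) fun t d => hnn (i, t) d
    exact ⟨.inl V, fun t d => hV t.1 t.2 d⟩

/-! ### Every listed surface is a vertex normal surface -/

/-- A block solution whose support lies in that of a vertex solution is a multiple of it. -/
theorem BlockVertex.toVec_eq_mul (V : BlockVertex) {p : ℝ} {P : BlockParams ℝ}
    (h : ∀ t d, V.params.toVec 1 t d = 0 → P.toVec p t d = 0) (t : Fin 4) (d : NormalDisc) :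
    P.toVec p t d = p * V.params.toVec 1 t d := by
  suffices P.link = p * V.params.link ∧ P.q₁ = p * V.params.q₁ ∧ P.q₂ = p * V.params.q₂ ∧
      P.q₃ = p * V.params.q₃ ∧ P.q₄ = p * V.params.q₄ by
    obtain ⟨e1, e2, e3, e4, e5⟩ := this
    rcases d with v | q
    · fin_cases t <;> fin_cases v <;> simp [BlockParams.toVec, e1, e2, e3, e4, e5] <;> ring
    · fin_cases t <;> fin_cases q <;> simp [BlockParams.toVec, e1, e2, e3, e4, e5]
  have h1 := h 0 (.inl 0)
  have h2 := h 0 (.inl 1)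
  have h3 := h 0 (.inl 2)
  have h4 := h 0 (.inr 0)
  have h5 := h 1 (.inl 0)
  have h6 := h 1 (.inr 0)
  have h7 := h 2 (.inl 0)
  have h8 := h 2 (.inl 1)
  have h9 := h 2 (.inr 0)
  have h10 := h 3 (.inl 0)
  have h11 := h 3 (.inl 1)
  have h12 := h 3 (.inr 0)
  clear h
  simp only [BlockParams.toVec, Matrix.cons_val, Sum.elim_inl, Sum.elim_inr]
    at h1 h2 h3 h4 h5 h6 h7 h8 h9 h10 h11 h12
  -- For each of the 17 vertices the vanishing coordinates are linear equations that determine all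
  -- five parameters from `p`.
  rcases V with _ | ⟨_ | _, _ | _, _ | _, _ | _⟩ <;>
    simp [BlockVertex.params] at h1 h2 h3 h4 h5 h6 h7 h8 h9 h10 h11 h12 ⊢ <;>
    refine ⟨?_, ?_, ?_, ?_, ?_⟩ <;> linarith

theorem onExtremalRay_vertexSurface {k : ℕ} (hk : 1 ≤ k) (s : Fin k → Bool)
    (c : (Fin k → BlockVertex) ⊕ Fin k) :
    (pathological k s).OnExtremalRay fun t d => (vertexSurface c t d : ℝ) := by
  have hn := isNormalSurface_vertexSurface s c
  refine ⟨hn.intCast_mem_solutionCone, fun h0 => ?_, ?_⟩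
  · obtain ⟨t, d, h1⟩ := exists_vertexSurface_eq_one hk c
    have := congrFun (congrFun h0 t) d
    simp [h1] at this
  intro y hy z hz hyz
  have hsupp : ∀ t d, vertexSurface c t d = 0 → y t d = 0 := by
    intro t d h0
    have e := congrFun (congrFun hyz t) d
    simp only [Pi.add_apply, h0, Int.cast_zero] at e
    linarith [hy.1 t d, hz.1 t d]
  -- The cone does not impose the quadrilateral constraints; the summand inherits them because its
  -- support lies in that of the surface.
  have hq : Triangulation.QuadConstraints y := fun t q q' h h' =>
    hn.2.2 t q q' (fun h0 => h (hsupp _ _ h0)) fun h0 => h' (hsupp _ _ h0)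
  obtain ⟨p, P, rfl⟩ := exists_eq_surfaceVec hk hy.2 hq
  rcases c with V | i
  · refine ⟨p, ?_⟩
    funext t d
    exact (V t.1).toVec_eq_mul (p := p) (P := P t.1) (fun t' d' => hsupp (t.1, t') d') t.2 d
  · refine ⟨(P i).link, ?_⟩
    have hp : p = 0 := by
      have := hsupp (i, 1) (.inl 1)
      simpa [vertexSurface, surfaceVec, BlockParams.toVec] using this
    subst hp
    funext ⟨j, t⟩ d
    have h1 := hsupp (j, 0) (.inr 0)
    have h2 := hsupp (j, 1) (.inr 0)
    have h3 := hsupp (j, 2) (.inr 0)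
    have h4 := hsupp (j, 3) (.inr 0)
    have h5 := hsupp (j, 1) (.inl 0)
    simp [vertexSurface, surfaceVec, BlockParams.toVec, linkParams] at h1 h2 h3 h4 h5
    have key : (P j).link = if j = i then (P i).link else 0 := by
      split_ifs with hj
      · rw [hj]
      · exact h5 hj
    rcases d with v | q
    · fin_cases t <;> fin_cases v <;>
        simp [vertexSurface, linkParams, surfaceVec, BlockParams.toVec, h1, h2, h3, h4, key]
    · fin_cases t <;> fin_cases q <;>
        simp [vertexSurface, linkParams, surfaceVec, BlockParams.toVec, h1, h2, h3, h4]

theorem isVertexNormalSurface_iff {k : ℕ} (hk : 1 ≤ k) (s : Fin k → Bool)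
    (x : Fin k × Fin 4 → NormalDisc → ℤ) :
    (pathological k s).IsVertexNormalSurface x ↔ x ∈ Set.range vertexSurface := by
  refine ⟨fun hx => hx.exists_eq_vertexSurface hk, ?_⟩
  rintro ⟨c, rfl⟩
  refine ⟨isNormalSurface_vertexSurface s c, onExtremalRay_vertexSurface hk s c, ?_⟩
  rintro ⟨w, m, -, hm, he⟩
  obtain ⟨t, d, h1⟩ := exists_vertexSurface_eq_one hk c
  have h : (m : ℤ) ∣ 1 := ⟨w t d, by rw [← h1, he]; simp⟩
  have := Int.le_of_dvd one_pos h
  omega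

theorem lemma4 (k : ℕ) (hk : 1 ≤ k) (s : Fin k → Bool) :
    (pathological k s).size = 4 * k ∧
      (pathological k s).vertexCount = 17 ^ k + k := by
  refine ⟨by simp [Triangulation.size, mul_comm], ?_⟩
  have hset : {x | (pathological k s).IsVertexNormalSurface x} = Set.range vertexSurface :=
    Set.ext fun x => isVertexNormalSurface_iff hk s x
  rw [Triangulation.vertexCount, hset, ← Set.image_univ,
    Set.ncard_image_of_injective _ vertexSurface_injective, Set.ncard_univ,
    Nat.card_eq_fintype_card]
  simp
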